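/- Let $U$ be an ultrafilter on a set $I$ and, for a set $X$, let ${}^*X=X^I/U$ be the ultrapower; internal sets are the classes of families of sets. Let $\eta\in{}^*\mathbb N\setminus\mathbb N$ and let $\omega\in{}^*\mathbb N$ satisfy $\omega\ge n\eta$ for all $n\in\mathbb N$. Put $$\overline{\mathcal R}_{\omega,\eta}=\{\tau\in{}^*\mathbb R:\ -\tfrac{\omega}{\eta}\le\tau<\tfrac{\omega}{\eta}\},$$ let $\mathfrak C$ be the algebra of all unions $\bigcup_{i\in J}[\tfrac i\eta,\tfrac{i+1}\eta)$ with $J$ an internal subset of $\{i\in{}^*\mathbb Z:-\omega\le i<\omega\}$, and let $\lambda$ give this union the mass $|J|/\eta\in{}^*\mathbb R$, where $|J|$ is the internal cardinality of $J$. Let $(\overline{\mathcal R}_{\omega,\eta},L(\mathfrak C),L(\lambda))$ be the associated Loeb space: the Carathéodory extension of the standard part ${}^\circ\lambda$ (with value $\infty$ where $\lambda$ is infinite) to the $\sigma$-algebra generated by $\mathfrak C$, completed. Let $(\mathbb R,\mathfrak B,\mu)$ be the completed Lebesgue measure space, let $\mathfrak B'$ be the $\sigma$-algebra of all $B\subseteq[-\infty,\infty]$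 with $B\cap\mathbb R\in\mathfrak B$, and let $\mu'$ be the measure on $\mathfrak B'$ that extends $\mu$ and satisfies $\mu'(\{\infty\})=\mu'(\{-\infty\})=\infty$. Let $st:\overline{\mathcal R}_{\omega,\eta}\to[-\infty,\infty]$ be the standard part map, which sends positive infinite elements to $+\infty$ and negative infinite elements to $-\infty$. Then $$st:(\overline{\mathcal R}_{\omega,\eta},L(\mathfrak C),L(\lambda))\to([-\infty,\infty],\mathfrak B',\mu')$$ is measurable and measure preserving. In particular, let $g:\mathbb R\to\mathbb C$ be a Schwartz function and $\hat g(t)=\int_{-\infty}^{\infty}g(x)e^{-\pi ixt}\,dx$, and let $g_\infty,\hat g_\infty$ be the extensions of $g,\hat g$ to $[-\infty,\infty]$ by $0$ at $\pm\infty$. Then $g_\infty\circ st$ and $\hat g_\infty\circ st$ are integrable with respect to $L(\lambda)$, $g_\infty$ and $\hat g_\infty$ are integrable with respect to $\mu'$, $g$ and $\hat g$ are integrable with respect to $\mu$, and $$\int_{\overline{\mathcal R}_{\omega,\eta}}g_\infty\circ st\;dL(\lambda)=\int_{[-\infty,\infty]}g_\infty\,d\mu'=\int_{\mathbb R}g\,d\mu,\qquad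 \int_{\overline{\mathcal R}_{\omega,\eta}}\hat g_\infty\circ st\;dL(\lambda)=\int_{[-\infty,\infty]}\hat g_\infty\,d\mu'=\int_{\mathbb R}\hat g\,d\mu .$$ -/

import Mathlib

open MeasureTheory Filter
open scoped ENNReal SchwartzMap

noncomputable section

namespace LoebGrid

universe u

variable {I : Type u} {U : Ultrafilter I}

/-! ### Hyperreals, hypernaturals, hyperintegers

The nonstandard extension is the ultrapower along the ultrafilter `U`: `*X` is
`Germ (U : Filter I) X`.  Internal sets are germs of sets, and hyperfinite sets are germs of
finite sets. -/

/-- The inclusion of the hypernaturals in the hyperreals. -/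
def natToHyper (n : Germ (U : Filter I) ℕ) : Germ (U : Filter I) ℝ := n.map (fun k : ℕ => (k : ℝ))

/-- The inclusion of the hyperintegers in the hyperreals. -/
def intToHyper (i : Germ (U : Filter I) ℤ) : Germ (U : Filter I) ℝ := i.map (fun k : ℤ => (k : ℝ))

/-- The internal cardinality of a hyperfinite set of hyperintegers, as a hypernatural. -/
def hyperCard (J : Germ (U : Filter I) (Finset ℤ)) : Germ (U : Filter I) ℕ := J.map Finset.card

/-- The standard part of a hyperreal, as an extended real: `⊤` and `⊥` on the positive and negative
infinite hyperreals (`ArchimedeanClass.mk x < 0` says that `x` is infinite). -/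
def st (x : Germ (U : Filter I) ℝ) : EReal :=
  if ArchimedeanClass.mk x < 0 then (if 0 < x then ⊤ else ⊥)
  else ((ArchimedeanClass.stdPart x : ℝ) : EReal)

/-! ### The hyperfinite measure space -/

/-- The space `{τ ∈ *ℝ : -ω/η ≤ τ < ω/η}`. -/
def Space (ω η : Germ (U : Filter I) ℕ) : Type u :=
  {τ : Germ (U : Filter I) ℝ //
    -(natToHyper ω / natToHyper η) ≤ τ ∧ τ < natToHyper ω / natToHyper η}

/-- The cell `[i/η, (i+1)/η)`, as a subset of the space. -/
def cell (ω η : Germ (U : Filter I) ℕ) (i : Germ (U : Filter I) ℤ) : Set (Space ω η) :=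
  {x | intToHyper i / natToHyper η ≤ x.1 ∧ x.1 < (intToHyper i + 1) / natToHyper η}

/-- The hyperfinite set `{i ∈ *ℤ : -ω ≤ i < ω}`. -/
def cellIndices (ω : Germ (U : Filter I) ℕ) : Germ (U : Filter I) (Finset ℤ) :=
  ω.map (fun n : ℕ => Finset.Ico (-(n : ℤ)) (n : ℤ))

/-- The internal set `J` consists of indices `i` with `-ω ≤ i < ω`. -/
def IsIndexSet (ω : Germ (U : Filter I) ℕ) (J : Germ (U : Filter I) (Finset ℤ)) : Prop :=
  Germ.LiftRel (fun S T : Finset ℤ => S ⊆ T) J (cellIndices ω)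

/-- The internal union of the cells with index in `J`. -/
def cellUnion (ω η : Germ (U : Filter I) ℕ) (J : Germ (U : Filter I) (Finset ℤ)) :
    Set (Space ω η) :=
  {x | ∃ i : Germ (U : Filter I) ℤ,
    Germ.LiftRel (fun (k : ℤ) (S : Finset ℤ) => k ∈ S) i J ∧ x ∈ cell ω η i}

/-- The internal algebra of internal unions of cells. -/
def internalAlgebra (ω η : Germ (U : Filter I) ℕ) : Set (Set (Space ω η)) :=
  {A | ∃ J, IsIndexSet ω J ∧ A = cellUnion ω η J}

/-- The internal counting measure: each cell has mass `1/η`, so the union of the cells with index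
in `J` has mass `|J|/η`. -/
def countingMeasure (η : Germ (U : Filter I) ℕ) (J : Germ (U : Filter I) (Finset ℤ)) :
    Germ (U : Filter I) ℝ :=
  natToHyper (hyperCard J) / natToHyper η

/-- The standard part of the internal counting measure on the internal algebra (the index set `J`
of a member is unique), extended by `∞` to all the other sets. -/
def premeasure (ω η : Germ (U : Filter I) ℕ) (A : Set (Space ω η)) : ℝ≥0∞ :=
  ⨅ (J : Germ (U : Filter I) (Finset ℤ)) (_ : IsIndexSet ω J) (_ : A = cellUnion ω η J),
    (st (countingMeasure η J)).toENNReal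

theorem st_nonneg {a : Germ (U : Filter I) ℝ} (ha : 0 ≤ a) : 0 ≤ st a := by
  unfold st
  split_ifs with h1 h2
  · exact le_top
  · have : a = 0 := le_antisymm (not_lt.1 h2) ha
    subst this
    simp at h1
  · exact_mod_cast ArchimedeanClass.stdPart_nonneg ha

theorem st_add_le {a b : Germ (U : Filter I) ℝ} (ha : 0 ≤ a) (hb : 0 ≤ b) :
    (st a).toENNReal + (st b).toENNReal ≤ (st (a + b)).toENNReal := by
  rw [← EReal.toENNReal_add (st_nonneg ha) (st_nonneg hb)]
  apply EReal.toENNReal_le_toENNReal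
  by_cases h : ArchimedeanClass.mk (a + b) < 0
  · have h0 : 0 < a + b := by
      rcases (add_nonneg ha hb).lt_or_eq with h' | h'
      · exact h'
      · rw [← h'] at h
        simp at h
    have : st (a + b) = ⊤ := by
      unfold st
      rw [if_pos h, if_pos h0]
    rw [this]
    exact le_top
  · have hle : ∀ c : Germ (U : Filter I) ℝ, 0 ≤ c → c ≤ a + b → 0 ≤ ArchimedeanClass.mk c := by
      intro c hc hcab
      exact (not_lt.1 h).trans (ArchimedeanClass.mk_antitoneOn hc (hc.trans hcab) hcab)
    have h1 := hle a ha (le_add_of_nonneg_right hb)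
    have h2 := hle b hb (le_add_of_nonneg_left ha)
    unfold st
    rw [if_neg h, if_neg (not_lt.2 h1), if_neg (not_lt.2 h2),
      ArchimedeanClass.stdPart_add h1 h2]
    exact_mod_cast le_rfl

theorem countingMeasure_nonneg (η : Germ (U : Filter I) ℕ) (J : Germ (U : Filter I) (Finset ℤ)) :
    0 ≤ countingMeasure η J := by
  induction J using Germ.inductionOn with | _ J
  induction η using Germ.inductionOn with | _ η
  refine Germ.coe_le.2 (Eventually.of_forall fun i => ?_)
  simp only [Function.comp_apply]
  positivity

/-- Distinct cells are disjoint. -/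
theorem cell_index_unique {ω η : Germ (U : Filter I) ℕ} {i j : Germ (U : Filter I) ℤ}
    {x : Space ω η} (hi : x ∈ cell ω η i) (hj : x ∈ cell ω η j) : i = j := by
  obtain ⟨x, hx⟩ := x
  obtain ⟨h1, h2⟩ := hi
  obtain ⟨h3, h4⟩ := hj
  dsimp only at h1 h2 h3 h4
  clear hx
  induction x using Germ.inductionOn with | _ x
  induction η using Germ.inductionOn with | _ η
  induction i using Germ.inductionOn with | _ i
  induction j using Germ.inductionOn with | _ j
  have h1 := Germ.coe_le.1 h1
  have h2 := Germ.coe_lt.1 h2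
  have h3 := Germ.coe_le.1 h3
  have h4 := Germ.coe_lt.1 h4
  refine Germ.coe_eq.2 ?_
  filter_upwards [h1, h2, h3, h4] with k h1 h2 h3 h4
  change (i k : ℝ) / (η k : ℝ) ≤ x k at h1
  change x k < ((i k : ℝ) + 1) / (η k : ℝ) at h2
  change (j k : ℝ) / (η k : ℝ) ≤ x k at h3
  change x k < ((j k : ℝ) + 1) / (η k : ℝ) at h4
  rcases Nat.eq_zero_or_pos (η k) with h0 | h0
  · simp only [h0, Nat.cast_zero, div_zero] at h1 h2
    linarith
  · have h0' : (0 : ℝ) < η k := by exact_mod_cast h0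
    have h5 := (div_lt_div_iff_of_pos_right h0').1 (h1.trans_lt h4)
    have h6 := (div_lt_div_iff_of_pos_right h0').1 (h3.trans_lt h2)
    have h5 : i k < j k + 1 := by exact_mod_cast h5
    have h6 : j k < i k + 1 := by exact_mod_cast h6
    omega

theorem mem_cellUnion_iff {ω η : Germ (U : Filter I) ℕ} {J : Germ (U : Filter I) (Finset ℤ)}
    {i : Germ (U : Filter I) ℤ} {x : Space ω η} (hx : x ∈ cell ω η i) :
    x ∈ cellUnion ω η J ↔ Germ.LiftRel (fun (k : ℤ) (S : Finset ℤ) => k ∈ S) i J := by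
  constructor
  · rintro ⟨j, hj, hxj⟩
    rwa [cell_index_unique hx hxj]
  · exact fun h => ⟨i, h, hx⟩

theorem cellUnion_inter (ω η : Germ (U : Filter I) ℕ) (J K : Germ (U : Filter I) (Finset ℤ)) :
    cellUnion ω η (Germ.map₂ (fun S T => S ∩ T) K J) = cellUnion ω η K ∩ cellUnion ω η J := by
  have key : ∀ i : Germ (U : Filter I) ℤ,
      Germ.LiftRel (fun (k : ℤ) (S : Finset ℤ) => k ∈ S) i (Germ.map₂ (fun S T => S ∩ T) K J) ↔
      Germ.LiftRel (fun (k : ℤ) (S : Finset ℤ) => k ∈ S) i K ∧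
      Germ.LiftRel (fun (k : ℤ) (S : Finset ℤ) => k ∈ S) i J := by
    intro i
    induction i using Germ.inductionOn with | _ i
    induction J using Germ.inductionOn with | _ J
    induction K using Germ.inductionOn with | _ K
    simp [Germ.map₂_coe, Germ.liftRel_coe, eventually_and]
  ext x
  constructor
  · rintro ⟨i, hi, hx⟩
    exact ⟨⟨i, ((key i).1 hi).1, hx⟩, ⟨i, ((key i).1 hi).2, hx⟩⟩
  · rintro ⟨⟨i, hi, hx⟩, hJ⟩
    exact ⟨i, (key i).2 ⟨hi, (mem_cellUnion_iff hx).1 hJ⟩, hx⟩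

theorem cellUnion_sdiff (ω η : Germ (U : Filter I) ℕ) (J K : Germ (U : Filter I) (Finset ℤ)) :
    cellUnion ω η (Germ.map₂ (fun S T => S \ T) K J) = cellUnion ω η K \ cellUnion ω η J := by
  have key : ∀ i : Germ (U : Filter I) ℤ,
      Germ.LiftRel (fun (k : ℤ) (S : Finset ℤ) => k ∈ S) i (Germ.map₂ (fun S T => S \ T) K J) ↔
      Germ.LiftRel (fun (k : ℤ) (S : Finset ℤ) => k ∈ S) i K ∧
      ¬ Germ.LiftRel (fun (k : ℤ) (S : Finset ℤ) => k ∈ S) i J := by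
    intro i
    induction i using Germ.inductionOn with | _ i
    induction J using Germ.inductionOn with | _ J
    induction K using Germ.inductionOn with | _ K
    simp only [Germ.map₂_coe, Germ.liftRel_coe, ← Ultrafilter.eventually_not, ← eventually_and,
      Finset.mem_sdiff]
  ext x
  constructor
  · rintro ⟨i, hi, hx⟩
    exact ⟨⟨i, ((key i).1 hi).1, hx⟩, fun hJ => ((key i).1 hi).2 ((mem_cellUnion_iff hx).1 hJ)⟩
  · rintro ⟨⟨i, hi, hx⟩, hJ⟩
    exact ⟨i, (key i).2 ⟨hi, fun h => hJ ((mem_cellUnion_iff hx).2 h)⟩, hx⟩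

theorem isIndexSet_map₂ {ω : Germ (U : Filter I) ℕ} {K : Germ (U : Filter I) (Finset ℤ)}
    (J : Germ (U : Filter I) (Finset ℤ)) (f : Finset ℤ → Finset ℤ → Finset ℤ)
    (hf : ∀ S T, f S T ⊆ S) (hK : IsIndexSet ω K) : IsIndexSet ω (Germ.map₂ f K J) := by
  induction J using Germ.inductionOn with | _ J
  induction K using Germ.inductionOn with | _ K
  induction ω using Germ.inductionOn with | _ ω
  have hK : ∀ᶠ k in (U : Filter I), K k ⊆ Finset.Ico (-(ω k : ℤ)) (ω k : ℤ) := hK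
  show ∀ᶠ k in (U : Filter I), f (K k) (J k) ⊆ Finset.Ico (-(ω k : ℤ)) (ω k : ℤ)
  exact hK.mono fun k hk => (hf _ _).trans hk

theorem countingMeasure_inter_add_sdiff (η : Germ (U : Filter I) ℕ)
    (J K : Germ (U : Filter I) (Finset ℤ)) :
    countingMeasure η (Germ.map₂ (fun S T => S ∩ T) K J) +
      countingMeasure η (Germ.map₂ (fun S T => S \ T) K J) = countingMeasure η K := by
  unfold countingMeasure
  rw [← add_div]
  congr 1
  induction J using Germ.inductionOn with | _ J
  induction K using Germ.inductionOn with | _ K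
  refine Germ.coe_eq.2 (Eventually.of_forall fun k => ?_)
  have := Finset.card_inter_add_card_sdiff (K k) (J k)
  show ((K k ∩ J k).card : ℝ) + ((K k \ J k).card : ℝ) = ((K k).card : ℝ)
  exact_mod_cast this

theorem premeasure_empty (ω η : Germ (U : Filter I) ℕ) : premeasure ω η ∅ = 0 := by
  refine le_antisymm ?_ zero_le
  have h1 : IsIndexSet ω (((fun _ => ∅ : I → Finset ℤ)) : Germ (U : Filter I) (Finset ℤ)) := by
    induction ω using Germ.inductionOn with | _ ω
    show ∀ᶠ k in (U : Filter I), (∅ : Finset ℤ) ⊆ Finset.Ico (-(ω k : ℤ)) (ω k : ℤ)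
    exact Eventually.of_forall fun k => Finset.empty_subset _
  have h2 : (∅ : Set (Space ω η)) =
      cellUnion ω η (((fun _ => ∅ : I → Finset ℤ)) : Germ (U : Filter I) (Finset ℤ)) := by
    symm
    rw [Set.eq_empty_iff_forall_notMem]
    rintro x ⟨i, hi, -⟩
    induction i using Germ.inductionOn with | _ i
    have hi : ∀ᶠ k in (U : Filter I), i k ∈ (∅ : Finset ℤ) := hi
    obtain ⟨k, hk⟩ := hi.exists
    simp at hk
  have h3 : countingMeasure η (((fun _ => ∅ : I → Finset ℤ)) : Germ (U : Filter I) (Finset ℤ))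
      = 0 := by
    unfold countingMeasure
    have : natToHyper (hyperCard (((fun _ => ∅ : I → Finset ℤ)) :
        Germ (U : Filter I) (Finset ℤ))) = 0 :=
      Germ.coe_eq.2 (Eventually.of_forall fun k => by simp)
    rw [this, zero_div]
  have h4 : (st (countingMeasure η (((fun _ => ∅ : I → Finset ℤ)) :
      Germ (U : Filter I) (Finset ℤ)))).toENNReal = 0 := by
    rw [h3]
    simp [st]
  exact iInf_le_of_le _ (iInf_le_of_le h1 (iInf_le_of_le h2 h4.le))

/-- The index set of a member of the internal algebra is unique, so the internal counting measure is
well defined on it. -/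
theorem cellUnion_injective {ω η : Germ (U : Filter I) ℕ} (hη : 0 < natToHyper η)
    {J K : Germ (U : Filter I) (Finset ℤ)} (hJ : IsIndexSet ω J) (hK : IsIndexSet ω K)
    (h : cellUnion ω η J = cellUnion ω η K) : J = K := by
  classical
  induction J using Germ.inductionOn with | _ J
  induction K using Germ.inductionOn with | _ K
  induction ω using Germ.inductionOn with | _ ω
  induction η using Germ.inductionOn with | _ η
  have hJ : ∀ᶠ k in (U : Filter I), J k ⊆ Finset.Ico (-(ω k : ℤ)) (ω k : ℤ) := hJ
  have hK : ∀ᶠ k in (U : Filter I), K k ⊆ Finset.Ico (-(ω k : ℤ)) (ω k : ℤ) := hK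
  have hη : ∀ᶠ k in (U : Filter I), (0 : ℝ) < η k := Germ.coe_pos.1 hη
  refine Germ.coe_eq.2 ?_
  by_contra hne
  have hne : ∀ᶠ k in (U : Filter I), J k ≠ K k := Ultrafilter.eventually_not.2 hne
  have hex : ∀ k, ∃ i : ℤ, J k ≠ K k → ¬ (i ∈ J k ↔ i ∈ K k) := by
    intro k
    by_cases hk : J k = K k
    · exact ⟨0, fun h' => absurd hk h'⟩
    · by_contra hcon
      push Not at hcon
      exact hk (Finset.ext fun i => (hcon i).2)
  choose i hi using hex
  have hmem : ∀ᶠ k in (U : Filter I), i k ∈ Finset.Ico (-(ω k : ℤ)) (ω k : ℤ) := by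
    filter_upwards [hJ, hK, hne] with k h1 h2 h3
    have := hi k h3
    by_cases h4 : i k ∈ J k
    · exact h1 h4
    · exact h2 (by tauto)
  let τ : Germ (U : Filter I) ℝ := ((fun k => (i k : ℝ) / (η k : ℝ) : I → ℝ))
  have hτ1 : -(natToHyper (ω : Germ (U : Filter I) ℕ) / natToHyper (η : Germ (U : Filter I) ℕ))
      ≤ τ := by
    show ∀ᶠ k in (U : Filter I), -((ω k : ℝ) / (η k : ℝ)) ≤ (i k : ℝ) / (η k : ℝ)
    filter_upwards [hmem, hη] with k h1 h2
    rw [← neg_div]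
    gcongr
    exact_mod_cast (Finset.mem_Ico.1 h1).1
  have hτ2 : τ < natToHyper (ω : Germ (U : Filter I) ℕ) /
      natToHyper (η : Germ (U : Filter I) ℕ) := by
    refine Germ.coe_lt.2 ?_
    filter_upwards [hmem, hη] with k h1 h2
    show (i k : ℝ) / (η k : ℝ) < (ω k : ℝ) / (η k : ℝ)
    gcongr
    exact_mod_cast (Finset.mem_Ico.1 h1).2
  let x : Space (ω : Germ (U : Filter I) ℕ) (η : Germ (U : Filter I) ℕ) := ⟨τ, hτ1, hτ2⟩
  have hx : x ∈ cell (ω : Germ (U : Filter I) ℕ) (η : Germ (U : Filter I) ℕ)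
      (i : Germ (U : Filter I) ℤ) := by
    refine ⟨le_rfl, Germ.coe_lt.2 ?_⟩
    filter_upwards [hη] with k h2
    show (i k : ℝ) / (η k : ℝ) < ((i k : ℝ) + 1) / (η k : ℝ)
    gcongr
    linarith
  have h1 : x ∈ cellUnion _ _ (J : Germ (U : Filter I) (Finset ℤ)) ↔
      x ∈ cellUnion _ _ (K : Germ (U : Filter I) (Finset ℤ)) := by rw [h]
  rw [mem_cellUnion_iff hx, mem_cellUnion_iff hx] at h1
  have h1 : (∀ᶠ k in (U : Filter I), i k ∈ J k) ↔ (∀ᶠ k in (U : Filter I), i k ∈ K k) := h1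
  by_cases h2 : ∀ᶠ k in (U : Filter I), i k ∈ J k
  · obtain ⟨k, h3, h4, h5⟩ := (hne.and (h2.and (h1.1 h2))).exists
    exact hi k h3 (by tauto)
  · have h3 := Ultrafilter.eventually_not.2 h2
    have h4 := Ultrafilter.eventually_not.2 (fun h' => h2 (h1.2 h'))
    obtain ⟨k, h3, h4, h5⟩ := (hne.and (h3.and h4)).exists
    exact hi k h3 (by tauto)

theorem premeasure_cellUnion {ω η : Germ (U : Filter I) ℕ} (hη : 0 < natToHyper η)
    {J : Germ (U : Filter I) (Finset ℤ)} (hJ : IsIndexSet ω J) :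
    premeasure ω η (cellUnion ω η J) = (st (countingMeasure η J)).toENNReal := by
  refine le_antisymm (iInf_le_of_le J (iInf_le_of_le hJ (iInf_le_of_le rfl le_rfl))) ?_
  refine le_iInf fun K => le_iInf fun hK => le_iInf fun h => ?_
  rw [cellUnion_injective hη hJ hK h]

/-- The Carathéodory outer measure of the standard part of the internal counting measure. -/
def loebOuterMeasure (ω η : Germ (U : Filter I) ℕ) : OuterMeasure (Space ω η) :=
  OuterMeasure.ofFunction (premeasure ω η) (premeasure_empty ω η)

theorem generateFrom_le_caratheodory (ω η : Germ (U : Filter I) ℕ) :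
    MeasurableSpace.generateFrom (internalAlgebra ω η) ≤ (loebOuterMeasure ω η).caratheodory := by
  refine MeasurableSpace.generateFrom_le ?_
  rintro _ ⟨J, -, rfl⟩
  refine OuterMeasure.ofFunction_caratheodory fun t => ?_
  conv_rhs => unfold premeasure
  refine le_iInf fun K => le_iInf fun hK => le_iInf fun ht => ?_
  subst ht
  rw [← cellUnion_inter, ← cellUnion_sdiff, ← countingMeasure_inter_add_sdiff η J K]
  refine le_trans (add_le_add ?_ ?_)
    (st_add_le (countingMeasure_nonneg _ _) (countingMeasure_nonneg _ _))
  · exact iInf_le_of_le _ (iInf_le_of_le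
      (isIndexSet_map₂ J _ (fun _ _ => Finset.inter_subset_left) hK) (iInf_le_of_le rfl le_rfl))
  · exact iInf_le_of_le _ (iInf_le_of_le
      (isIndexSet_map₂ J _ (fun _ _ => Finset.sdiff_subset) hK) (iInf_le_of_le rfl le_rfl))

/-- The extension of the standard part of the internal counting measure to the σ-algebra generated
by the internal algebra. -/
def loebMeasureAux (ω η : Germ (U : Filter I) ℕ) :
    @Measure (Space ω η) (MeasurableSpace.generateFrom (internalAlgebra ω η)) :=
  @OuterMeasure.toMeasure _ (MeasurableSpace.generateFrom (internalAlgebra ω η))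
    (loebOuterMeasure ω η) (generateFrom_le_caratheodory ω η)

/-- The Loeb σ-algebra: the completion of the σ-algebra generated by the internal algebra. -/
@[reducible] def loebSigma (ω η : Germ (U : Filter I) ℕ) : MeasurableSpace (Space ω η) :=
  @NullMeasurableSpace.instMeasurableSpace (Space ω η)
    (MeasurableSpace.generateFrom (internalAlgebra ω η)) (loebMeasureAux ω η)

/-- The Loeb measure. -/
def loebMeasure (ω η : Germ (U : Filter I) ℕ) : @Measure (Space ω η) (loebSigma ω η) :=
  @Measure.completion (Space ω η) (MeasurableSpace.generateFrom (internalAlgebra ω η))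
    (loebMeasureAux ω η)

/-- The standard part map on the hyperfinite measure space. -/
def stMap (ω η : Germ (U : Filter I) ℕ) (x : Space ω η) : EReal := st x.1

/-! ### The extended real line -/

/-- The σ-algebra of Lebesgue measurable subsets of `ℝ`. -/
@[reducible] def lebesgueSigma : MeasurableSpace ℝ :=
  inferInstanceAs (MeasurableSpace (NullMeasurableSpace ℝ (volume : Measure ℝ)))

/-- Completed Lebesgue measure. -/
def lebesgueMeasure : @Measure ℝ lebesgueSigma := (volume : Measure ℝ).completion

/-- The σ-algebra of those sets of extended reals whose real part is Lebesgue measurable. -/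
@[reducible] def extendedSigma : MeasurableSpace EReal := lebesgueSigma.map (fun x : ℝ => (x : EReal))

/-- Completed Lebesgue measure on the extended reals, with infinite mass at each of `±∞`. -/
def extendedMeasure : @Measure EReal extendedSigma :=
  @Measure.map ℝ EReal lebesgueSigma extendedSigma (fun x : ℝ => (x : EReal)) lebesgueMeasure
    + (∞ : ℝ≥0∞) • @Measure.dirac EReal extendedSigma ⊤
    + (∞ : ℝ≥0∞) • @Measure.dirac EReal extendedSigma ⊥

/-- The extension of a function on `ℝ` by the value `0` at `±∞`. -/
def extendZero (f : ℝ → ℂ) (x : EReal) : ℂ := if x = ⊤ ∨ x = ⊥ then 0 else f x.toReal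

/-- The Fourier transform with kernel `exp (-π i x t)`. -/
def fourierPi (g : ℝ → ℂ) (t : ℝ) : ℂ :=
  ∫ x : ℝ, g x * Complex.exp (-(Real.pi * Complex.I * x * t))

end LoebGrid

end

open LoebGrid

open MeasureTheory Filter
open scoped ENNReal SchwartzMap Topology

noncomputable section

namespace LoebGrid

universe u

variable {I : Type u} {U : Ultrafilter I}

/-! ### Standard parts as limits along the ultrafilter -/

/-! Representing germs by families indexed by `I` turns every standard part into a limit along `U`
in the compact space of extended reals (`tendsto_st`), so assertions about infinite and
infinitesimal elements become assertions about limits.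

The Loeb measure has the expected value on the internal algebra because of countable saturation
(`exists_section_notMem`). No assumption on `U` is needed for this: the infinite hypernatural `η`
already provides a diagonal argument. Hence a countable cover of one internal union of cells by
others has a finite subcover, and the outer measure agrees with the standard part of the counting
measure (`loebOuterMeasure_cellUnion`).

For real `a < b`, the internal union of the cells with index in `[aη, bη)` has mass infinitely close
to `b - a`. It contains the preimage of `(a, b)` under the standard part map and is contained in the
preimage of `[a, b]`. Shrinking the interval shows that the preimage of `(a, b)` has measure `b - a`
(`loebMeasureAux_preimage_Ioo`). The preimages of `±∞` each contain an internal union of at least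
`ω/2` cells, whose mass is infinite since `ω/η` is.

A measure on the extended reals is determined by its part on `ℝ` and its two masses at `±∞`
(`measure_ereal_ext`), so the image of the Loeb measure is known on Borel sets, and completion gives
the full statement. The integral identities are changes of variables: the infinite masses sit where
the integrand vanishes, and the Fourier transform is a dilated Schwartz function. -/

/-- The diagonal embedding of the reals in the hyperreals. -/
def realToHyper : ℝ →+*o Germ (U : Filter I) ℝ where
  toFun r := ((fun _ => r : I → ℝ) : Germ (U : Filter I) ℝ)
  map_zero' := rfl
  map_one' := rfl
  map_add' _ _ := rfl
  map_mul' _ _ := rfl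
  monotone' _ _ h := Germ.coe_le.2 (Eventually.of_forall fun _ => h)

/-- The standard part of a hyperreal is its limit along the ultrafilter in the extended reals. -/
theorem tendsto_st (f : I → ℝ) :
    Tendsto (fun k => (f k : EReal)) U (𝓝 (st (f : Germ (U : Filter I) ℝ))) := by
  unfold st
  split_ifs with h1 h2
  · rw [EReal.tendsto_nhds_top_iff_real]
    intro r
    obtain ⟨n, hn⟩ := exists_nat_ge r
    -- Since `0` is the class of `1`, a negative class means by definition that `n * 1 < |x|` for
    -- every natural `n`.
    have h3 := h1 n
    simp only [ArchimedeanOrder.val_of, abs_one, nsmul_eq_mul, mul_one, abs_of_pos h2] at h3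
    have h4 : ∀ᶠ k in (U : Filter I), (n : ℝ) < f k := Germ.coe_lt.1 h3
    filter_upwards [h4] with k hk
    exact_mod_cast hn.trans_lt hk
  · rw [EReal.tendsto_nhds_bot_iff_real]
    intro r
    obtain ⟨n, hn⟩ := exists_nat_ge (-r)
    have h3 := h1 n
    simp only [ArchimedeanOrder.val_of, abs_one, nsmul_eq_mul, mul_one,
      abs_of_nonpos (not_lt.1 h2)] at h3
    have h4 : ∀ᶠ k in (U : Filter I), (n : ℝ) < - f k := Germ.coe_lt.1 h3
    filter_upwards [h4] with k hk
    have : f k < r := by linarith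
    exact_mod_cast this
  -- For a finite element it suffices to test order neighbourhoods: a real strictly below (above)
  -- the standard part is strictly below (above) the element itself, hence `U`-almost everywhere
  -- below (above) the family.
  · refine (continuous_coe_real_ereal.tendsto _).comp
      (tendsto_order.2 ⟨fun a ha => ?_, fun a ha => ?_⟩)
    · exact Germ.coe_lt.1 (ArchimedeanClass.lt_of_lt_stdPart realToHyper (not_lt.1 h1) ha)
    · exact Germ.coe_lt.1 (ArchimedeanClass.lt_of_stdPart_lt realToHyper (not_lt.1 h1) ha)

theorem st_eq_of_tendsto {f : I → ℝ} {a : EReal}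
    (h : Tendsto (fun k => (f k : EReal)) U (𝓝 a)) : st (f : Germ (U : Filter I) ℝ) = a :=
  tendsto_nhds_unique (tendsto_st f) h

theorem tendsto_toENNReal_st (f : I → ℝ) :
    Tendsto (fun k => ENNReal.ofReal (f k)) U
      (𝓝 (st (f : Germ (U : Filter I) ℝ)).toENNReal) := by
  refine ((EReal.continuous_toENNReal.tendsto _).comp (tendsto_st (U := U) f)).congr fun k => ?_
  simp [EReal.toENNReal]

/-! ### Infinite hypernaturals -/

/-- Each standard value is avoided `U`-almost everywhere, hence so are the finitely many values
below `n` simultaneously. -/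
theorem tendsto_atTop_of_ne_natCast {η : I → ℕ}
    (hη : ∀ n : ℕ, (η : Germ (U : Filter I) ℕ) ≠ (n : Germ (U : Filter I) ℕ)) :
    Tendsto η U atTop := by
  refine tendsto_atTop.2 fun n => ?_
  have h : ∀ᶠ k in (U : Filter I), ∀ m ∈ Finset.range n, η k ≠ m := by
    rw [eventually_all_finset]
    intro m _
    exact Ultrafilter.eventually_not.2 fun h => hη m (Germ.coe_eq.2 h)
  filter_upwards [h] with k hk
  by_contra! hlt
  exact hk _ (Finset.mem_range.2 hlt) rfl

theorem tendsto_atTop_of_natCast_mul_le {η ω : I → ℕ} (hη : Tendsto η U atTop)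
    (hω : ∀ n : ℕ, (n : Germ (U : Filter I) ℕ) * (η : Germ (U : Filter I) ℕ) ≤ ω) :
    Tendsto (fun k => (ω k : ℝ) / (η k : ℝ)) U atTop := by
  refine tendsto_atTop.2 fun r => ?_
  obtain ⟨n, hn⟩ := exists_nat_ge r
  have h1 : ∀ᶠ k in (U : Filter I), n * η k ≤ ω k := Germ.coe_le.1 (hω n)
  filter_upwards [h1, hη.eventually_gt_atTop 0] with k hk h0
  have h0' : (0 : ℝ) < η k := by exact_mod_cast h0
  rw [le_div_iff₀ h0']
  refine (mul_le_mul_of_nonneg_right hn h0'.le).trans ?_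
  exact_mod_cast hk

/-! ### Countable saturation and the Loeb outer measure -/

/-- The ultrapower is countably saturated when the ultrafilter admits an infinite hypernatural:
an internal family which is not covered by finitely many members of a sequence of internal sets
has an internal point outside all of them. -/
theorem exists_section_notMem {α : Type*} [Inhabited α] {η : I → ℕ} (hη : Tendsto η U atTop)
    (A : I → Set α) (B : ℕ → I → Set α)
    (h : ∀ N, ∀ᶠ k in (U : Filter I), ¬ A k ⊆ ⋃ n ≤ N, B n k) :
    ∃ s : I → α, (∀ᶠ k in (U : Filter I), s k ∈ A k) ∧
      ∀ n, ∀ᶠ k in (U : Filter I), s k ∉ B n k := by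
  classical
  let P : I → ℕ → Prop := fun k N => ¬ A k ⊆ ⋃ n ≤ N, B n k
  -- The diagonal index: the greatest `N ≤ η k` for which the first sets up to `N` fail to cover.
  -- The cap `η k` makes it exist, and since `η` is infinite `M` still exceeds every standard `n`
  -- almost everywhere.
  let M : I → ℕ := fun k => Nat.findGreatest (P k) (η k)
  have hs : ∀ k, ∃ a : α, P k (M k) → a ∈ A k ∧ ∀ n ≤ M k, a ∉ B n k := by
    intro k
    by_cases hk : P k (M k)
    · obtain ⟨a, ha, hb⟩ := Set.not_subset.1 hk
      simp only [Set.mem_iUnion, not_exists] at hb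
      exact ⟨a, fun _ => ⟨ha, hb⟩⟩
    -- This occurs only on a `U`-null set of indices, so the value is irrelevant.
    · exact ⟨default, fun h => absurd h hk⟩
  choose s hs using hs
  have key : ∀ n, ∀ᶠ k in (U : Filter I), n ≤ M k ∧ P k (M k) := by
    intro n
    filter_upwards [h n, hη.eventually_ge_atTop n] with k hk hn
    exact ⟨Nat.le_findGreatest hn hk, Nat.findGreatest_spec (P := P k) hn hk⟩
  exact ⟨s, (key 0).mono fun k hk => (hs k hk.2).1,
    fun n => (key n).mono fun k hk => (hs k hk.2).2 n hk.1⟩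

theorem natToHyper_pos {η : I → ℕ} (hη : Tendsto η U atTop) :
    0 < natToHyper (η : Germ (U : Filter I) ℕ) := by
  refine Germ.coe_pos.2 ?_
  filter_upwards [hη.eventually_gt_atTop 0] with k hk
  exact Nat.cast_pos.2 hk

/-- A point of the space lies in the cell whose index is the floor of its product with `η`. -/
theorem mem_cell_floor {ω : Germ (U : Filter I) ℕ} {η : I → ℕ} (hη : Tendsto η U atTop)
    {x : Space ω η} {f : I → ℝ} (hx : x.1 = (f : Germ (U : Filter I) ℝ)) :
    x ∈ cell ω η ((fun k => ⌊f k * η k⌋ : I → ℤ) : Germ (U : Filter I) ℤ) := by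
  unfold cell
  rw [Set.mem_ofPred_eq, hx]
  constructor
  · refine Germ.coe_le.2 ?_
    filter_upwards [hη.eventually_gt_atTop 0] with k hk
    have hk' : (0 : ℝ) < η k := by exact_mod_cast hk
    show (⌊f k * η k⌋ : ℝ) / (η k : ℝ) ≤ f k
    rw [div_le_iff₀ hk']
    exact Int.floor_le _
  · refine Germ.coe_lt.2 ?_
    filter_upwards [hη.eventually_gt_atTop 0] with k hk
    have hk' : (0 : ℝ) < η k := by exact_mod_cast hk
    show f k < ((⌊f k * η k⌋ : ℝ) + 1) / (η k : ℝ)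
    rw [lt_div_iff₀ hk']
    exact Int.lt_floor_add_one _

theorem mem_cellUnion_iff_floor {ω : Germ (U : Filter I) ℕ} {η : I → ℕ} (hη : Tendsto η U atTop)
    {x : Space ω η} {f : I → ℝ} (hx : x.1 = (f : Germ (U : Filter I) ℝ)) (J : I → Finset ℤ) :
    x ∈ cellUnion ω η (J : Germ (U : Filter I) (Finset ℤ)) ↔
      ∀ᶠ k in (U : Filter I), ⌊f k * η k⌋ ∈ J k :=
  mem_cellUnion_iff (mem_cell_floor hη hx)

/-- The cells with index in `cellIndices ω` are not empty. -/
theorem cell_nonempty {ω η : I → ℕ} (hη : Tendsto η U atTop) {i : I → ℤ}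
    (hi : ∀ᶠ k in (U : Filter I), i k ∈ Finset.Ico (-(ω k : ℤ)) (ω k : ℤ)) :
    (cell (ω : Germ (U : Filter I) ℕ) (η : Germ (U : Filter I) ℕ)
      (i : Germ (U : Filter I) ℤ)).Nonempty := by
  have hη0 := hη.eventually_gt_atTop 0
  refine ⟨⟨((fun k => (i k : ℝ) / (η k : ℝ) : I → ℝ)), Germ.coe_le.2 ?_, Germ.coe_lt.2 ?_⟩,
    le_rfl, Germ.coe_lt.2 ?_⟩
  · filter_upwards [hi] with k h1
    show -((ω k : ℝ) / (η k : ℝ)) ≤ (i k : ℝ) / (η k : ℝ)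
    rw [← neg_div]
    gcongr
    exact_mod_cast (Finset.mem_Ico.1 h1).1
  · filter_upwards [hi, hη0] with k h1 h2
    show (i k : ℝ) / (η k : ℝ) < (ω k : ℝ) / (η k : ℝ)
    gcongr
    exact_mod_cast (Finset.mem_Ico.1 h1).2
  · filter_upwards [hη0] with k h2
    show (i k : ℝ) / (η k : ℝ) < ((i k : ℝ) + 1) / (η k : ℝ)
    gcongr
    linarith

/-- Finite subadditivity of cardinality holds at each index and passes to the limit along `U`. -/
theorem toENNReal_st_countingMeasure_le_sum {η : I → ℕ} {J : I → Finset ℤ}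
    {K : ℕ → I → Finset ℤ} {N : ℕ}
    (h : ∀ᶠ k in (U : Filter I), (J k : Set ℤ) ⊆ ⋃ n ≤ N, (K n k : Set ℤ)) :
    (st (countingMeasure (η : Germ (U : Filter I) ℕ)
        (J : Germ (U : Filter I) (Finset ℤ)))).toENNReal ≤
      ∑ n ∈ Finset.range (N + 1), (st (countingMeasure (η : Germ (U : Filter I) ℕ)
        (K n : Germ (U : Filter I) (Finset ℤ)))).toENNReal := by
  refine le_of_tendsto_of_tendsto (tendsto_toENNReal_st fun k => ((J k).card : ℝ) / (η k : ℝ))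
    (tendsto_finsetSum _ fun n _ =>
      tendsto_toENNReal_st fun k => ((K n k).card : ℝ) / (η k : ℝ)) ?_
  filter_upwards [h] with k hk
  rw [← ENNReal.ofReal_sum_of_nonneg fun _ _ => by positivity, ← Finset.sum_div]
  have hsub : J k ⊆ (Finset.range (N + 1)).biUnion fun n => K n k := by
    intro i hi
    have := hk hi
    simp only [Set.mem_iUnion] at this
    obtain ⟨n, hn, hin⟩ := this
    exact Finset.mem_biUnion.2 ⟨n, Finset.mem_range.2 (Nat.lt_succ_of_le hn), hin⟩
  have hcard : ((J k).card : ℝ) ≤ ∑ n ∈ Finset.range (N + 1), ((K n k).card : ℝ) := by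
    exact_mod_cast (Finset.card_le_card hsub).trans Finset.card_biUnion_le
  gcongr

/-- The Loeb outer measure extends the standard part of the internal counting measure. -/
theorem loebOuterMeasure_cellUnion {ω η : I → ℕ} (hη : Tendsto η U atTop) {J : I → Finset ℤ}
    (hJ : ∀ᶠ k in (U : Filter I), J k ⊆ Finset.Ico (-(ω k : ℤ)) (ω k : ℤ)) :
    loebOuterMeasure (ω : Germ (U : Filter I) ℕ) (η : Germ (U : Filter I) ℕ)
        (cellUnion _ _ (J : Germ (U : Filter I) (Finset ℤ))) =
      (st (countingMeasure (η : Germ (U : Filter I) ℕ)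
        (J : Germ (U : Filter I) (Finset ℤ)))).toENNReal := by
  have hη0 := natToHyper_pos hη
  have hJ' : IsIndexSet (ω : Germ (U : Filter I) ℕ) (J : Germ (U : Filter I) (Finset ℤ)) := hJ
  refine le_antisymm ((OuterMeasure.ofFunction_le _).trans (premeasure_cellUnion hη0 hJ').le) ?_
  unfold loebOuterMeasure
  rw [OuterMeasure.ofFunction_apply]
  refine le_iInf₂ fun t ht => ?_
  -- Sets outside the internal algebra have premeasure `∞`, so a cover using one of them gives no
  -- constraint; otherwise every member of the cover comes from an index set.
  by_cases htop : ∃ n, premeasure (ω : Germ (U : Filter I) ℕ) (η : Germ (U : Filter I) ℕ) (t n) = ⊤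
  · rw [ENNReal.tsum_eq_top_of_eq_top htop]
    exact le_top
  push Not at htop
  have hex : ∀ n, ∃ K : I → Finset ℤ,
      IsIndexSet (ω : Germ (U : Filter I) ℕ) (K : Germ (U : Filter I) (Finset ℤ)) ∧
      t n = cellUnion _ _ (K : Germ (U : Filter I) (Finset ℤ)) := by
    intro n
    have h := lt_top_iff_ne_top.2 (htop n)
    simp only [premeasure, iInf_lt_iff] at h
    obtain ⟨K, hK, hKt, -⟩ := h
    induction K using Germ.inductionOn with | _ K
    exact ⟨K, hK, hKt⟩
  choose K hK hKt using hex
  have hfin : ∃ N, ∀ᶠ k in (U : Filter I), (J k : Set ℤ) ⊆ ⋃ n ≤ N, (K n k : Set ℤ) := by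
    -- Saturation would give an index in `J` lying in none of the `K n`; any point of its cell would
    -- then belong to the covered set but to no member of the cover.
    by_contra! hcon
    obtain ⟨i, hi, hiK⟩ := exists_section_notMem hη (fun k => (J k : Set ℤ))
      (fun n k => (K n k : Set ℤ)) hcon
    obtain ⟨x, hx⟩ := cell_nonempty (U := U) hη (i := i) (ω := ω) <| by
      filter_upwards [hi, hJ] with k h1 h2 using h2 h1
    obtain ⟨n, hn⟩ := Set.mem_iUnion.1 (ht ((mem_cellUnion_iff hx).2 hi))
    rw [hKt n, mem_cellUnion_iff hx] at hn
    have hn : ∀ᶠ k in (U : Filter I), i k ∈ K n k := hn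
    obtain ⟨k, h1, h2⟩ := (hn.and (hiK n)).exists
    exact h2 h1
  obtain ⟨N, hN⟩ := hfin
  refine (toENNReal_st_countingMeasure_le_sum hN).trans ?_
  refine le_trans (Finset.sum_le_sum fun n _ => ?_) (ENNReal.sum_le_tsum (Finset.range (N + 1)))
  rw [hKt n, premeasure_cellUnion hη0 (hK n)]

theorem measurableSet_cellUnion {ω η : I → ℕ} {J : I → Finset ℤ}
    (hJ : ∀ᶠ k in (U : Filter I), J k ⊆ Finset.Ico (-(ω k : ℤ)) (ω k : ℤ)) :
    MeasurableSet[MeasurableSpace.generateFrom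
        (internalAlgebra (ω : Germ (U : Filter I) ℕ) (η : Germ (U : Filter I) ℕ))]
      (cellUnion (ω : Germ (U : Filter I) ℕ) (η : Germ (U : Filter I) ℕ)
        (J : Germ (U : Filter I) (Finset ℤ))) := by
  have hJ' : IsIndexSet (ω : Germ (U : Filter I) ℕ) (J : Germ (U : Filter I) (Finset ℤ)) := hJ
  exact MeasurableSpace.measurableSet_generateFrom ⟨_, hJ', rfl⟩

theorem loebMeasureAux_cellUnion {ω η : I → ℕ} (hη : Tendsto η U atTop) {J : I → Finset ℤ}
    (hJ : ∀ᶠ k in (U : Filter I), J k ⊆ Finset.Ico (-(ω k : ℤ)) (ω k : ℤ)) :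
    loebMeasureAux (ω : Germ (U : Filter I) ℕ) (η : Germ (U : Filter I) ℕ)
        (cellUnion _ _ (J : Germ (U : Filter I) (Finset ℤ))) =
      (st (countingMeasure (η : Germ (U : Filter I) ℕ)
        (J : Germ (U : Filter I) (Finset ℤ)))).toENNReal := by
  unfold loebMeasureAux
  rw [@toMeasure_apply _ (_) _ _ _ (measurableSet_cellUnion hJ), loebOuterMeasure_cellUnion hη hJ]

/-! ### The standard part map on internal intervals -/

/-- The interval of hyperintegers `[⌈a * η⌉, ⌈b * η⌉)`. -/
def ceilInterval (η : I → ℕ) (a b : ℝ) (k : I) : Finset ℤ := Finset.Ico ⌈a * η k⌉ ⌈b * η k⌉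

theorem mem_ceilInterval {η : I → ℕ} {a b : ℝ} {k : I} {i : ℤ} :
    i ∈ ceilInterval η a b k ↔ a * η k ≤ i ∧ (i : ℝ) < b * η k := by
  rw [ceilInterval, Finset.mem_Ico, Int.ceil_le, Int.lt_ceil]

/-- This is where infinite `ω/η` enters: cells over a bounded real interval have admissible indices.
-/
theorem eventually_lt_div_of_lt {ω η : I → ℕ} (hη : Tendsto η U atTop)
    (hω : Tendsto (fun k => (ω k : ℝ) / (η k : ℝ)) U atTop) (b : ℝ) :
    ∀ᶠ k in (U : Filter I), b * η k < ω k := by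
  filter_upwards [hη.eventually_gt_atTop 0, hω.eventually_gt_atTop b] with k h0 h1
  have h0' : (0 : ℝ) < η k := by exact_mod_cast h0
  exact (lt_div_iff₀ h0').1 h1

theorem ceilInterval_subset {ω η : I → ℕ} (hη : Tendsto η U atTop)
    (hω : Tendsto (fun k => (ω k : ℝ) / (η k : ℝ)) U atTop) (a b : ℝ) :
    ∀ᶠ k in (U : Filter I), ceilInterval η a b k ⊆ Finset.Ico (-(ω k : ℤ)) (ω k : ℤ) := by
  filter_upwards [eventually_lt_div_of_lt hη hω (-a), eventually_lt_div_of_lt hη hω b]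
    with k h1 h2 i hi
  rw [mem_ceilInterval] at hi
  rw [Finset.mem_Ico]
  constructor
  · have : (-(ω k : ℝ)) ≤ i := by linarith
    exact_mod_cast this
  · have : (i : ℝ) < ω k := hi.2.trans h2
    exact_mod_cast this

theorem tendsto_natCast_inv {η : I → ℕ} (hη : Tendsto η U atTop) :
    Tendsto (fun k => (1 : ℝ) / (η k : ℝ)) U (𝓝 0) :=
  tendsto_one_div_atTop_nhds_zero_nat.comp hη

/-- Rounding up costs less than one cell, that is, at most the infinitesimal `1/η`. -/
theorem tendsto_ceil_div {η : I → ℕ} (hη : Tendsto η U atTop) (a : ℝ) :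
    Tendsto (fun k => (⌈a * η k⌉ : ℝ) / (η k : ℝ)) U (𝓝 a) := by
  have h : Tendsto (fun k => a + (1 : ℝ) / (η k : ℝ)) U (𝓝 a) := by
    simpa using tendsto_const_nhds.add (tendsto_natCast_inv hη)
  refine tendsto_of_tendsto_of_tendsto_of_le_of_le' tendsto_const_nhds h ?_ ?_
  · filter_upwards [hη.eventually_gt_atTop 0] with k h0
    have h0' : (0 : ℝ) < η k := by exact_mod_cast h0
    rw [le_div_iff₀ h0']
    exact Int.le_ceil _
  · filter_upwards [hη.eventually_gt_atTop 0] with k h0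
    have h0' : (0 : ℝ) < η k := by exact_mod_cast h0
    rw [div_le_iff₀ h0', add_mul, one_div_mul_cancel h0'.ne']
    exact (Int.ceil_lt_add_one _).le

theorem st_countingMeasure_ceilInterval {η : I → ℕ} (hη : Tendsto η U atTop) {a b : ℝ}
    (hab : a ≤ b) :
    st (countingMeasure (η : Germ (U : Filter I) ℕ)
      (ceilInterval η a b : Germ (U : Filter I) (Finset ℤ))) = ((b - a : ℝ) : EReal) := by
  have h : countingMeasure (η : Germ (U : Filter I) ℕ)
      (ceilInterval η a b : Germ (U : Filter I) (Finset ℤ)) =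
      ((fun k => (⌈b * η k⌉ : ℝ) / (η k : ℝ) - (⌈a * η k⌉ : ℝ) / (η k : ℝ) : I → ℝ) :
        Germ (U : Filter I) ℝ) := by
    refine Germ.coe_eq.2 (Eventually.of_forall fun k => ?_)
    show ((ceilInterval η a b k).card : ℝ) / (η k : ℝ) = _
    have hle : ⌈a * η k⌉ ≤ ⌈b * η k⌉ := Int.ceil_mono (by gcongr)
    have hc : ((ceilInterval η a b k).card : ℤ) = ⌈b * η k⌉ - ⌈a * η k⌉ := by
      rw [ceilInterval, Int.card_Ico, Int.toNat_of_nonneg (by linarith)]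
    have hc' : ((ceilInterval η a b k).card : ℝ) = ⌈b * η k⌉ - ⌈a * η k⌉ := by exact_mod_cast hc
    rw [hc', sub_div]
  rw [h]
  exact st_eq_of_tendsto ((continuous_coe_real_ereal.tendsto _).comp
    ((tendsto_ceil_div hη b).sub (tendsto_ceil_div hη a)))

/-- The union of the cells whose index is below `⌈q * η⌉`. -/
def lowerUnion (U : Ultrafilter I) (ω η : I → ℕ) (q : ℝ) :
    Set (Space (ω : Germ (U : Filter I) ℕ) (η : Germ (U : Filter I) ℕ)) :=
  cellUnion _ _ ((fun k => Finset.Ico (-(ω k : ℤ)) ⌈q * η k⌉ : I → Finset ℤ) :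
    Germ (U : Filter I) (Finset ℤ))

/-- The union of the cells whose index is in `[⌈a * η⌉, ⌈b * η⌉)`. -/
def intervalUnion (U : Ultrafilter I) (ω η : I → ℕ) (a b : ℝ) :
    Set (Space (ω : Germ (U : Filter I) ℕ) (η : Germ (U : Filter I) ℕ)) :=
  cellUnion _ _ (ceilInterval η a b : Germ (U : Filter I) (Finset ℤ))

theorem measurableSet_lowerUnion {ω η : I → ℕ} (hη : Tendsto η U atTop)
    (hω : Tendsto (fun k => (ω k : ℝ) / (η k : ℝ)) U atTop) (q : ℝ) :
    MeasurableSet[MeasurableSpace.generateFrom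
        (internalAlgebra (ω : Germ (U : Filter I) ℕ) (η : Germ (U : Filter I) ℕ))]
      (lowerUnion U ω η q) := by
  refine measurableSet_cellUnion ?_
  filter_upwards [eventually_lt_div_of_lt hη hω q] with k hk
  refine Finset.Ico_subset_Ico le_rfl (Int.ceil_le.2 ?_)
  exact_mod_cast hk.le

/-- A strict bound on the limit holds almost everywhere for the family. The converse
`stMap_le_of_mem_lowerUnion` gives only a weak inequality, because points of the internal union can
be infinitely close to `q`. -/
theorem mem_lowerUnion_of_stMap_lt {ω η : I → ℕ} (hη : Tendsto η U atTop)
    {x : Space (ω : Germ (U : Filter I) ℕ) (η : Germ (U : Filter I) ℕ)} {q : ℝ}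
    (h : stMap _ _ x < q) : x ∈ lowerUnion U ω η q := by
  obtain ⟨f, hf⟩ := Quot.exists_rep x.1
  have hf : x.1 = (f : Germ (U : Filter I) ℝ) := hf.symm
  rw [lowerUnion, mem_cellUnion_iff_floor hη hf]
  have h1 : ∀ᶠ k in (U : Filter I), -((ω k : ℝ) / (η k : ℝ)) ≤ f k :=
    Germ.coe_le.1 (hf ▸ x.2.1)
  rw [stMap, hf] at h
  filter_upwards [(tendsto_st f).eventually_lt_const h, h1, hη.eventually_gt_atTop 0]
    with k h2 h3 h0
  have h0' : (0 : ℝ) < η k := by exact_mod_cast h0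
  have h2 : f k < q := by exact_mod_cast h2
  rw [Finset.mem_Ico, Int.le_floor, Int.lt_ceil]
  constructor
  · rw [← neg_div, div_le_iff₀ h0'] at h3
    exact_mod_cast h3
  · exact (Int.floor_le _).trans_lt (by gcongr)

/-- If the index of the cell of `x` is below `b * η` then the standard part of `x` is at most
`b`. -/
theorem st_le_of_floor_lt {η : I → ℕ} (hη : Tendsto η U atTop) {f : I → ℝ} {b : ℝ}
    (h : ∀ᶠ k in (U : Filter I), (⌊f k * η k⌋ : ℝ) < b * η k) :
    st (f : Germ (U : Filter I) ℝ) ≤ b := by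
  have hb : Tendsto (fun k => b + (1 : ℝ) / (η k : ℝ)) U (𝓝 b) := by
    simpa using tendsto_const_nhds.add (tendsto_natCast_inv hη)
  refine le_of_tendsto_of_tendsto (tendsto_st f)
    ((continuous_coe_real_ereal.tendsto _).comp hb) ?_
  filter_upwards [h, hη.eventually_gt_atTop 0] with k hk h0
  have h0' : (0 : ℝ) < η k := by exact_mod_cast h0
  have h1 := Int.lt_floor_add_one (f k * η k)
  have : f k ≤ b + 1 / (η k : ℝ) := by
    rw [← mul_le_mul_iff_left₀ h0', add_mul, one_div_mul_cancel h0'.ne']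
    linarith
  exact EReal.coe_le_coe_iff.2 this

theorem le_st_of_le_floor {η : I → ℕ} (hη : Tendsto η U atTop) {f : I → ℝ} {a : ℝ}
    (h : ∀ᶠ k in (U : Filter I), a * η k ≤ (⌊f k * η k⌋ : ℝ)) :
    (a : EReal) ≤ st (f : Germ (U : Filter I) ℝ) := by
  refine le_of_tendsto_of_tendsto tendsto_const_nhds (tendsto_st f) ?_
  filter_upwards [h, hη.eventually_gt_atTop 0] with k hk h0
  have h0' : (0 : ℝ) < η k := by exact_mod_cast h0
  have := (mul_le_mul_iff_left₀ h0').1 (hk.trans (Int.floor_le _))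
  exact_mod_cast this

theorem stMap_le_of_mem_lowerUnion {ω η : I → ℕ} (hη : Tendsto η U atTop)
    {x : Space (ω : Germ (U : Filter I) ℕ) (η : Germ (U : Filter I) ℕ)} {q : ℝ}
    (h : x ∈ lowerUnion U ω η q) : stMap _ _ x ≤ q := by
  obtain ⟨f, hf⟩ := Quot.exists_rep x.1
  have hf : x.1 = (f : Germ (U : Filter I) ℝ) := hf.symm
  rw [lowerUnion, mem_cellUnion_iff_floor hη hf] at h
  rw [stMap, hf]
  refine st_le_of_floor_lt hη (h.mono fun k hk => ?_)
  exact Int.lt_ceil.1 (Finset.mem_Ico.1 hk).2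

theorem intervalUnion_subset {ω η : I → ℕ} (hη : Tendsto η U atTop) (a b : ℝ) :
    intervalUnion U ω η a b ⊆ stMap _ _ ⁻¹' Set.Icc (a : EReal) (b : EReal) := by
  intro x h
  obtain ⟨f, hf⟩ := Quot.exists_rep x.1
  have hf : x.1 = (f : Germ (U : Filter I) ℝ) := hf.symm
  rw [intervalUnion, mem_cellUnion_iff_floor hη hf] at h
  rw [Set.mem_preimage, stMap, hf]
  exact ⟨le_st_of_le_floor hη (h.mono fun k hk => (mem_ceilInterval.1 hk).1),
    st_le_of_floor_lt hη (h.mono fun k hk => (mem_ceilInterval.1 hk).2)⟩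

theorem preimage_Ioo_subset_intervalUnion {ω η : I → ℕ} (hη : Tendsto η U atTop) (a b : ℝ) :
    stMap _ _ ⁻¹' Set.Ioo (a : EReal) (b : EReal) ⊆ intervalUnion U ω η a b := by
  rintro x ⟨ha, hb⟩
  obtain ⟨f, hf⟩ := Quot.exists_rep x.1
  have hf : x.1 = (f : Germ (U : Filter I) ℝ) := hf.symm
  rw [intervalUnion, mem_cellUnion_iff_floor hη hf]
  -- Passing to the floor can lose one cell, so a standard gap `a' - a > 1/η` is inserted to keep
  -- the index at least `a * η`.
  obtain ⟨a', ha1, ha2⟩ := EReal.lt_iff_exists_real_btwn.1 ha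
  rw [stMap, hf] at ha2 hb
  have ha1 : a < a' := by exact_mod_cast ha1
  have hinv : ∀ᶠ k in (U : Filter I), 1 / (η k : ℝ) < a' - a :=
    (tendsto_natCast_inv hη).eventually_lt_const (sub_pos.2 ha1)
  filter_upwards [(tendsto_st f).eventually_const_lt ha2, (tendsto_st f).eventually_lt_const hb,
    hη.eventually_gt_atTop 0, hinv] with k h1 h2 h0 h3
  have h0' : (0 : ℝ) < η k := by exact_mod_cast h0
  have h1 : a' < f k := by exact_mod_cast h1
  have h2 : f k < b := by exact_mod_cast h2
  rw [mem_ceilInterval]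
  constructor
  · have h4 := Int.lt_floor_add_one (f k * η k)
    rw [div_lt_iff₀ h0'] at h3
    have h5 : a' * η k < f k * η k := by gcongr
    linarith [sub_mul a' a (η k : ℝ)]
  · exact (Int.floor_le _).trans_lt (by gcongr)

theorem loebMeasureAux_intervalUnion {ω η : I → ℕ} (hη : Tendsto η U atTop)
    (hω : Tendsto (fun k => (ω k : ℝ) / (η k : ℝ)) U atTop) {a b : ℝ} (hab : a ≤ b) :
    loebMeasureAux (ω : Germ (U : Filter I) ℕ) (η : Germ (U : Filter I) ℕ)
      (intervalUnion U ω η a b) = ENNReal.ofReal (b - a) := by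
  rw [intervalUnion, loebMeasureAux_cellUnion hη (ceilInterval_subset hη hω a b),
    st_countingMeasure_ceilInterval hη hab, EReal.toENNReal_of_ne_top (EReal.coe_ne_top _),
    EReal.toReal_coe]

/-! ### The standard part map is measure preserving -/

/-- A rational strictly between the standard part and `a` absorbs the discrepancy between strict and
weak inequalities, and the union stays countable. -/
theorem preimage_Iio_eq_iUnion_lowerUnion {ω η : I → ℕ} (hη : Tendsto η U atTop) (a : EReal) :
    stMap (ω : Germ (U : Filter I) ℕ) (η : Germ (U : Filter I) ℕ) ⁻¹' Set.Iio a =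
      ⋃ (q : ℚ) (_ : ((q : ℝ) : EReal) < a), lowerUnion U ω η q := by
  ext x
  simp only [Set.mem_preimage, Set.mem_Iio, Set.mem_iUnion, exists_prop]
  constructor
  · intro h
    obtain ⟨q, h1, h2⟩ := EReal.lt_iff_exists_rat_btwn.1 h
    exact ⟨q, h2, mem_lowerUnion_of_stMap_lt hη h1⟩
  · rintro ⟨q, h1, h2⟩
    exact (stMap_le_of_mem_lowerUnion hη h2).trans_lt h1

theorem measurable_stMap {ω η : I → ℕ} (hη : Tendsto η U atTop)
    (hω : Tendsto (fun k => (ω k : ℝ) / (η k : ℝ)) U atTop) :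
    @Measurable _ _ (MeasurableSpace.generateFrom
        (internalAlgebra (ω : Germ (U : Filter I) ℕ) (η : Germ (U : Filter I) ℕ))) (borel EReal)
      (stMap (ω : Germ (U : Filter I) ℕ) (η : Germ (U : Filter I) ℕ)) := by
  let _ := MeasurableSpace.generateFrom
        (internalAlgebra (ω : Germ (U : Filter I) ℕ) (η : Germ (U : Filter I) ℕ))
  refine measurable_of_Iio fun a => ?_
  rw [preimage_Iio_eq_iUnion_lowerUnion hη]
  exact MeasurableSet.iUnion fun q => MeasurableSet.iUnion fun _ => measurableSet_lowerUnion hη hω q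

/-- The internal interval from `a` to `b` bounds the preimage from outside; those from `a + ε` to `b
- ε` bound it from inside as `ε` decreases to `0`. -/
theorem loebMeasureAux_preimage_Ioo {ω η : I → ℕ} (hη : Tendsto η U atTop)
    (hω : Tendsto (fun k => (ω k : ℝ) / (η k : ℝ)) U atTop) (a b : ℝ) :
    loebMeasureAux (ω : Germ (U : Filter I) ℕ) (η : Germ (U : Filter I) ℕ)
      (stMap _ _ ⁻¹' Set.Ioo (a : EReal) (b : EReal)) = ENNReal.ofReal (b - a) := by
  rcases le_or_gt b a with hab | hab
  · rw [Set.Ioo_eq_empty (by simpa using hab), Set.preimage_empty, measure_empty,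
      ENNReal.ofReal_of_nonpos (by linarith)]
  refine le_antisymm ?_ ?_
  · rw [← loebMeasureAux_intervalUnion hη hω hab.le]
    exact measure_mono (preimage_Ioo_subset_intervalUnion hη a b)
  · have hlim : Tendsto (fun ε : ℝ => ENNReal.ofReal (b - ε - (a + ε))) (𝓝[>] 0)
        (𝓝 (ENNReal.ofReal (b - a))) := by
      have : Continuous fun ε : ℝ => ENNReal.ofReal (b - ε - (a + ε)) :=
        ENNReal.continuous_ofReal.comp (by fun_prop)
      simpa using (this.tendsto 0).mono_left nhdsWithin_le_nhds
    refine le_of_tendsto hlim ?_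
    filter_upwards [Ioo_mem_nhdsGT (show (0 : ℝ) < (b - a) / 2 by linarith)] with ε hε
    rw [← loebMeasureAux_intervalUnion hη hω (show a + ε ≤ b - ε by linarith [hε.2])]
    refine measure_mono ((intervalUnion_subset hη _ _).trans (Set.preimage_mono fun y hy => ?_))
    refine ⟨lt_of_lt_of_le ?_ hy.1, hy.2.trans_lt ?_⟩
    · exact EReal.coe_lt_coe_iff.2 (by linarith [hε.1])
    · exact EReal.coe_lt_coe_iff.2 (by linarith [hε.1])

/-! ### Infinite mass of the fibres over `±∞` -/

/-- One common lower bound for the masses and for the positions of the points below; the `- 1`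
leaves room for the integer division of `ω` by `2`. -/
theorem tendsto_half_sub_inv {ω η : I → ℕ} (hη : Tendsto η U atTop)
    (hω : Tendsto (fun k => (ω k : ℝ) / (η k : ℝ)) U atTop) :
    Tendsto (fun k => ((ω k : ℝ) / 2 - 1) / (η k : ℝ)) U atTop := by
  have h := (hω.atTop_div_const (show (0 : ℝ) < 2 by norm_num)).atTop_add
    (tendsto_natCast_inv hη).neg
  refine h.congr fun k => ?_
  ring

/-- Internal unions of at least `ω / 2` cells have infinite Loeb measure. -/
theorem loebMeasureAux_cellUnion_eq_top {ω η : I → ℕ} (hη : Tendsto η U atTop)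
    (hω : Tendsto (fun k => (ω k : ℝ) / (η k : ℝ)) U atTop) {J : I → Finset ℤ}
    (hJ : ∀ᶠ k in (U : Filter I), J k ⊆ Finset.Ico (-(ω k : ℤ)) (ω k : ℤ))
    (hcard : ∀ k, (ω k : ℝ) / 2 ≤ (J k).card) :
    loebMeasureAux (ω : Germ (U : Filter I) ℕ) (η : Germ (U : Filter I) ℕ)
        (cellUnion _ _ (J : Germ (U : Filter I) (Finset ℤ))) = ∞ := by
  rw [loebMeasureAux_cellUnion hη hJ]
  have h : Tendsto (fun k => ((J k).card : ℝ) / (η k : ℝ)) U atTop := by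
    refine tendsto_atTop_mono (fun k => ?_) (tendsto_half_sub_inv hη hω)
    gcongr
    linarith [hcard k]
  have hst : st (countingMeasure (η : Germ (U : Filter I) ℕ)
      (J : Germ (U : Filter I) (Finset ℤ))) = ⊤ :=
    st_eq_of_tendsto (f := fun k => ((J k).card : ℝ) / (η k : ℝ))
      (EReal.tendsto_coe_atTop.comp h)
  rw [hst, EReal.toENNReal_top]

/-- The cells with index from `ω / 2` up to `ω` consist of positive infinite points and already have
infinite total mass. -/
theorem loebMeasureAux_preimage_top {ω η : I → ℕ} (hη : Tendsto η U atTop)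
    (hω : Tendsto (fun k => (ω k : ℝ) / (η k : ℝ)) U atTop) :
    loebMeasureAux (ω : Germ (U : Filter I) ℕ) (η : Germ (U : Filter I) ℕ)
      (stMap _ _ ⁻¹' {⊤}) = ∞ := by
  refine top_le_iff.1 ?_
  rw [← loebMeasureAux_cellUnion_eq_top hη hω
    (J := fun k => Finset.Ico ((ω k / 2 : ℕ) : ℤ) (ω k : ℤ))
    (Eventually.of_forall fun k => Finset.Ico_subset_Ico (by lia) le_rfl) ?_]
  · refine measure_mono fun x h => ?_
    obtain ⟨f, hf⟩ := Quot.exists_rep x.1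
    have hf : x.1 = (f : Germ (U : Filter I) ℝ) := hf.symm
    rw [mem_cellUnion_iff_floor hη hf] at h
    rw [Set.mem_preimage, stMap, hf, Set.mem_singleton_iff]
    refine st_eq_of_tendsto (EReal.tendsto_coe_atTop.comp
      (tendsto_atTop_mono' _ ?_ (tendsto_half_sub_inv hη hω)))
    filter_upwards [h, hη.eventually_gt_atTop 0] with k hk h0
    have h0' : (0 : ℝ) < η k := by exact_mod_cast h0
    rw [div_le_iff₀ h0']
    refine le_trans ?_ (Int.floor_le _)
    have h1 : (ω k : ℤ) ≤ 2 * ⌊f k * η k⌋ + 1 := by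
      have := (Finset.mem_Ico.1 hk).1
      lia
    have h1 : (ω k : ℝ) ≤ 2 * ⌊f k * η k⌋ + 1 := by exact_mod_cast h1
    linarith
  · intro k
    have h1 : ω k ≤ 2 * (Finset.Ico ((ω k / 2 : ℕ) : ℤ) (ω k : ℤ)).card := by
      rw [Int.card_Ico]
      lia
    have h1 : (ω k : ℝ) ≤ 2 * (Finset.Ico ((ω k / 2 : ℕ) : ℤ) (ω k : ℤ)).card := by
      exact_mod_cast h1
    linarith

theorem loebMeasureAux_preimage_bot {ω η : I → ℕ} (hη : Tendsto η U atTop)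
    (hω : Tendsto (fun k => (ω k : ℝ) / (η k : ℝ)) U atTop) :
    loebMeasureAux (ω : Germ (U : Filter I) ℕ) (η : Germ (U : Filter I) ℕ)
      (stMap _ _ ⁻¹' {⊥}) = ∞ := by
  refine top_le_iff.1 ?_
  rw [← loebMeasureAux_cellUnion_eq_top hη hω
    (J := fun k => Finset.Ico (-(ω k : ℤ)) (-((ω k / 2 : ℕ) : ℤ)))
    (Eventually.of_forall fun k => Finset.Ico_subset_Ico le_rfl (by lia)) ?_]
  · refine measure_mono fun x h => ?_
    obtain ⟨f, hf⟩ := Quot.exists_rep x.1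
    have hf : x.1 = (f : Germ (U : Filter I) ℝ) := hf.symm
    rw [mem_cellUnion_iff_floor hη hf] at h
    rw [Set.mem_preimage, stMap, hf, Set.mem_singleton_iff]
    refine st_eq_of_tendsto (EReal.tendsto_coe_atBot.comp
      (tendsto_atBot_mono' _ ?_ (tendsto_neg_atTop_atBot.comp (tendsto_half_sub_inv hη hω))))
    filter_upwards [h, hη.eventually_gt_atTop 0] with k hk h0
    have h0' : (0 : ℝ) < η k := by exact_mod_cast h0
    rw [Function.comp_apply, ← neg_div, le_div_iff₀ h0']
    -- A point is only known to lie below the right end of its cell, so the bound is needed for the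
    -- index plus one; strictness of the upper index bound supplies it.
    have h1 : 2 * (⌊f k * η k⌋ + 1) ≤ -(ω k : ℤ) + 1 := by
      have := (Finset.mem_Ico.1 hk).2
      lia
    have h1 : 2 * ((⌊f k * η k⌋ : ℝ) + 1) ≤ -(ω k : ℝ) + 1 := by exact_mod_cast h1
    linarith [Int.lt_floor_add_one (f k * η k)]
  · intro k
    have h1 : ω k ≤ 2 * (Finset.Ico (-(ω k : ℤ)) (-((ω k / 2 : ℕ) : ℤ))).card := by
      rw [Int.card_Ico]
      lia
    have h1 : (ω k : ℝ) ≤ 2 * (Finset.Ico (-(ω k : ℤ)) (-((ω k / 2 : ℕ) : ℤ))).card := by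
      exact_mod_cast h1
    linarith

/-! ### Identification of the image measure on Borel sets -/

/-- Lebesgue measure on the Borel sets of extended reals, with infinite mass at each of `±∞`. -/
def extendedBorelMeasure : Measure EReal :=
  Measure.map (fun x : ℝ => (x : EReal)) volume + (∞ : ℝ≥0∞) • Measure.dirac ⊤
    + (∞ : ℝ≥0∞) • Measure.dirac ⊥

/-- A measure on the extended reals is determined by its restriction to the reals and by the masses
at `±∞`. -/
theorem measure_ereal_ext {μ ν : Measure EReal}
    (h : μ.comap ((↑) : ℝ → EReal) = ν.comap ((↑) : ℝ → EReal)) (htop : μ {⊤} = ν {⊤})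
    (hbot : μ {⊥} = ν {⊥}) : μ = ν := by
  ext s hs
  have key : ∀ ρ : Measure EReal, ρ s = ρ.comap ((↑) : ℝ → EReal) ((↑) ⁻¹' s)
      + (s.indicator 1 ⊤ * ρ {⊤} + s.indicator 1 ⊥ * ρ {⊥}) := by
    intro ρ
    rw [EReal.measurableEmbedding_coe.comap_apply, Set.image_preimage_eq_inter_range,
      ← measure_inter_add_sdiff s EReal.measurableEmbedding_coe.measurableSet_range]
    congr 1
    have hdiff : s \ Set.range ((↑) : ℝ → EReal) = (s ∩ {⊤}) ∪ (s ∩ {⊥}) := by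
      ext x
      induction x <;> simp
    rw [hdiff, measure_union ?_ (hs.inter (measurableSet_singleton _))]
    · congr 1
      · by_cases h : (⊤ : EReal) ∈ s <;> simp [h]
      · by_cases h : (⊥ : EReal) ∈ s <;> simp [h]
    · refine Set.disjoint_left.2 ?_
      rintro x ⟨-, h1⟩ ⟨-, h2⟩
      rw [Set.mem_singleton_iff] at h1 h2
      simp [h1] at h2
  rw [key μ, key ν, h, htop, hbot]

theorem comap_extendedBorelMeasure :
    extendedBorelMeasure.comap ((↑) : ℝ → EReal) = volume := by
  ext s hs
  rw [EReal.measurableEmbedding_coe.comap_apply, extendedBorelMeasure, Measure.add_apply,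
    Measure.add_apply, EReal.measurableEmbedding_coe.map_apply,
    Set.preimage_image_eq _ EReal.measurableEmbedding_coe.injective]
  simp

/-- The standard part map is measure preserving for Borel sets. -/
theorem measurePreserving_stMap_borel {ω η : I → ℕ} (hη : Tendsto η U atTop)
    (hω : Tendsto (fun k => (ω k : ℝ) / (η k : ℝ)) U atTop) :
    @MeasurePreserving _ _ (MeasurableSpace.generateFrom
        (internalAlgebra (ω : Germ (U : Filter I) ℕ) (η : Germ (U : Filter I) ℕ))) _
      (stMap _ _) (loebMeasureAux _ _) extendedBorelMeasure := by
  let _ := MeasurableSpace.generateFrom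
        (internalAlgebra (ω : Germ (U : Filter I) ℕ) (η : Germ (U : Filter I) ℕ))
  have hmeas : Measurable (stMap (ω : Germ (U : Filter I) ℕ) (η : Germ (U : Filter I) ℕ)) :=
    measurable_stMap hη hω
  refine ⟨hmeas, measure_ereal_ext ?_ ?_ ?_⟩
  · rw [comap_extendedBorelMeasure]
    -- Rational intervals determine the measure when one of the two is locally finite; the equality
    -- is reversed so that `volume` takes that role.
    refine (Real.measure_ext_Ioo_rat fun a b => ?_).symm
    rw [EReal.measurableEmbedding_coe.comap_apply, Measure.map_apply hmeas
      (EReal.measurableEmbedding_coe.measurableSet_image.2 measurableSet_Ioo),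
      EReal.image_coe_Ioo, loebMeasureAux_preimage_Ioo hη hω, Real.volume_Ioo]
  · rw [Measure.map_apply hmeas (measurableSet_singleton _), loebMeasureAux_preimage_top hη hω]
    simp [extendedBorelMeasure]
  · rw [Measure.map_apply hmeas (measurableSet_singleton _), loebMeasureAux_preimage_bot hη hω]
    simp [extendedBorelMeasure]

/-! ### Completions -/

theorem measurePreserving_of_measure_preimage {α β : Type*} {mα : MeasurableSpace α}
    {mβ : MeasurableSpace β} {μ : Measure α} {ν : Measure β} {f : α → β} (hf : Measurable f)
    (h : ∀ B, MeasurableSet B → μ (f ⁻¹' B) = ν B) : MeasurePreserving f μ ν :=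
  ⟨hf, Measure.ext fun B hB => (Measure.map_apply hf hB).trans (h B hB)⟩

theorem nullMeasurableSet_preimage_and_measure_preimage {α β : Type*} {mα : MeasurableSpace α}
    {mβ : MeasurableSpace β} {μ : Measure α} {ν : Measure β} {f : α → β}
    (h : MeasurePreserving f μ ν) {B : Set β} (hB : NullMeasurableSet B ν) :
    NullMeasurableSet (f ⁻¹' B) μ ∧ μ (f ⁻¹' B) = ν B :=
  ⟨hB.preimage h.quasiMeasurePreserving, h.measure_preimage hB⟩

/-- A measure preserving map remains so for the completion of the measure on the source and an
extension of the measure on the target to null measurable sets. -/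
theorem measurePreserving_completion {α β : Type*} {mα : MeasurableSpace α}
    {mβ mβ' : MeasurableSpace β} {μ : Measure α} {ν : @Measure β mβ} {ν' : @Measure β mβ'}
    {f : α → β} (h : @MeasurePreserving _ _ mα mβ f μ ν)
    (hν : ∀ B, MeasurableSet[mβ'] B → @NullMeasurableSet _ mβ B ν ∧ ν' B = ν B) :
    @MeasurePreserving (NullMeasurableSpace α μ) β _ mβ' f μ.completion ν' := by
  have key := fun B hB => nullMeasurableSet_preimage_and_measure_preimage h (hν B hB).1
  exact measurePreserving_of_measure_preimage (mα := NullMeasurableSpace.instMeasurableSpace)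
    (fun B hB => (key B hB).1) fun B hB => (key B hB).2.trans (hν B hB).2.symm

/-- The set is the image of its real part under a measurable embedding, together with at most two
points. -/
theorem nullMeasurableSet_extendedBorelMeasure {B : Set EReal} (hB : MeasurableSet[extendedSigma] B) :
    NullMeasurableSet B extendedBorelMeasure := by
  have hB' : NullMeasurableSet (((↑) : ℝ → EReal) ⁻¹' B) volume := hB
  have h1 : NullMeasurableSet (((↑) : ℝ → EReal) '' (((↑) : ℝ → EReal) ⁻¹' B))
      extendedBorelMeasure := by
    refine Measure.NullMeasurableSet.image _ _ EReal.measurableEmbedding_coe.injective (fun s hs =>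
      (EReal.measurableEmbedding_coe.measurableSet_image.2 hs).nullMeasurableSet) ?_
    rwa [comap_extendedBorelMeasure]
  have h2 : B = ((↑) : ℝ → EReal) '' (((↑) : ℝ → EReal) ⁻¹' B) ∪ (B ∩ {⊤, ⊥}) := by
    ext x
    induction x <;> simp
  rw [h2]
  exact h1.union ((Set.toFinite _).inter_of_right _).measurableSet.nullMeasurableSet

/-- Although `B` need not be Borel, images under a measurable embedding and Dirac measures with
measurable singletons are evaluated by the usual formulas on arbitrary sets. -/
theorem extendedMeasure_apply {B : Set EReal} (hB : MeasurableSet[extendedSigma] B) :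
    extendedMeasure B = extendedBorelMeasure B := by
  have h1 : @Measure.map ℝ EReal lebesgueSigma extendedSigma (fun x : ℝ => (x : EReal))
      lebesgueMeasure B = volume (((↑) : ℝ → EReal) ⁻¹' B) :=
    @Measure.map_apply _ _ lebesgueSigma extendedSigma _ _ (fun _ hs => hs) _ hB
  have h2 : ∀ a, @Measure.dirac EReal extendedSigma a B = Measure.dirac a B := fun a => by
    rw [@Measure.dirac_apply' _ extendedSigma _ _ hB, Measure.dirac_apply]
  rw [extendedMeasure, extendedBorelMeasure]
  simp only [Measure.add_apply, Measure.smul_apply]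
  rw [h1, h2, h2, EReal.measurableEmbedding_coe.map_apply]

/-- The standard part map from the Loeb space to the extended reals is measure preserving. -/
theorem measurePreserving_stMap {ω η : I → ℕ} (hη : Tendsto η U atTop)
    (hω : Tendsto (fun k => (ω k : ℝ) / (η k : ℝ)) U atTop) :
    @MeasurePreserving _ _ (loebSigma (ω : Germ (U : Filter I) ℕ) (η : Germ (U : Filter I) ℕ))
      extendedSigma (stMap _ _) (loebMeasure _ _) extendedMeasure := by
  exact measurePreserving_completion (measurePreserving_stMap_borel hη hω) fun B hB =>
    ⟨nullMeasurableSet_extendedBorelMeasure hB, extendedMeasure_apply hB⟩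

/-- Carries integrability from the Borel σ-algebra to the completed one. -/
theorem measurePreserving_id_lebesgueMeasure :
    @MeasurePreserving ℝ ℝ lebesgueSigma _ id lebesgueMeasure volume :=
  measurePreserving_of_measure_preimage (fun _ hs => hs.nullMeasurableSet) fun _ _ => rfl

/-! ### Integrals of functions extended by zero -/

theorem integral_comp_of_measurePreserving {α β : Type*} {mα : MeasurableSpace α}
    {mβ : MeasurableSpace β} {μ : Measure α} {ν : Measure β} {f : α → β}
    (hf : MeasurePreserving f μ ν) {g : β → ℂ} (hg : Integrable g ν) :
    Integrable (g ∘ f) μ ∧ ∫ x, (g ∘ f) x ∂μ = ∫ y, g y ∂ν := by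
  refine ⟨(hf.integrable_comp hg.aestronglyMeasurable).2 hg, ?_⟩
  rw [← hf.map_eq] at hg ⊢
  exact (integral_map hf.measurable.aemeasurable hg.aestronglyMeasurable).symm

/-- Infinite masses at zeros of a function do not contribute to its integral. -/
theorem integral_map_add_top_smul_dirac {α β : Type*} {mα : MeasurableSpace α}
    {mβ : MeasurableSpace β} {μ : Measure α} {c : α → β} (hc : Measurable c) {F : β → ℂ}
    (hF : Measurable F) {a b : β} (ha : F a = 0) (hb : F b = 0) (h : Integrable (F ∘ c) μ) :
    Integrable F (μ.map c + (∞ : ℝ≥0∞) • Measure.dirac a + (∞ : ℝ≥0∞) • Measure.dirac b) ∧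
      ∫ y, F y ∂(μ.map c + (∞ : ℝ≥0∞) • Measure.dirac a + (∞ : ℝ≥0∞) • Measure.dirac b) =
        ∫ x, F (c x) ∂μ := by
  -- Measurability of the zero set of `F` reduces the claim to the point `z`, and scaling by `∞`
  -- keeps null sets null.
  have hdirac : ∀ z, F z = 0 → F =ᵐ[(∞ : ℝ≥0∞) • Measure.dirac z] 0 := fun z hz =>
    Measure.ae_smul_measure ((ae_dirac_iff (hF (measurableSet_singleton 0))).2 hz) _
  have hmap : Integrable F (μ.map c) :=
    (integrable_map_measure hF.aestronglyMeasurable hc.aemeasurable).2 h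
  have hz : ∀ z, F z = 0 → Integrable F ((∞ : ℝ≥0∞) • Measure.dirac z) := fun z hz =>
    (integrable_congr (hdirac z hz)).2 (integrable_zero _ _ _)
  refine ⟨(hmap.add_measure (hz a ha)).add_measure (hz b hb), ?_⟩
  rw [integral_add_measure (hmap.add_measure (hz a ha)) (hz b hb),
    integral_add_measure hmap (hz a ha), integral_congr_ae (hdirac a ha),
    integral_congr_ae (hdirac b hb), integral_map hc.aemeasurable hF.aestronglyMeasurable]
  simp

theorem borel_le_extendedSigma : borel EReal ≤ extendedSigma := fun _ hs =>
  MeasurableSet.nullMeasurableSet (measurable_coe_real_ereal hs)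

theorem measurable_extendZero {f : ℝ → ℂ} (hf : Measurable f) : Measurable (extendZero f) := by
  refine Measurable.ite ?_ measurable_const (hf.comp measurable_ereal_toReal)
  exact (measurableSet_singleton _).union (measurableSet_singleton _)

theorem integral_extendZero {f : ℝ → ℂ} (hfm : Measurable f) (hf : Integrable f lebesgueMeasure) :
    Integrable (extendZero f) extendedMeasure ∧
      ∫ y, extendZero f y ∂extendedMeasure = ∫ t, f t ∂lebesgueMeasure := by
  have hcomp : extendZero f ∘ ((↑) : ℝ → EReal) = f := by
    ext x
    simp [extendZero]
  have h := integral_map_add_top_smul_dirac (mα := lebesgueSigma) (mβ := extendedSigma)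
    (μ := lebesgueMeasure) (c := fun x : ℝ => (x : EReal)) (F := extendZero f) (a := ⊤) (b := ⊥)
    (fun _ hs => hs) ((measurable_extendZero hfm).mono borel_le_extendedSigma le_rfl)
    (by simp [extendZero]) (by simp [extendZero]) (hcomp.symm ▸ hf)
  refine ⟨h.1, h.2.trans ?_⟩
  exact congrArg (fun F => ∫ t, F t ∂lebesgueMeasure) hcomp

theorem integrable_lebesgueMeasure {f : ℝ → ℂ} (hf : Integrable f) :
    Integrable f lebesgueMeasure :=
  (integral_comp_of_measurePreserving measurePreserving_id_lebesgueMeasure hf).1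

theorem integral_transfer {ω η : I → ℕ} (hη : Tendsto η U atTop)
    (hω : Tendsto (fun k => (ω k : ℝ) / (η k : ℝ)) U atTop) {f : ℝ → ℂ} (hfm : Measurable f)
    (hf : Integrable f) :
    Integrable (extendZero f ∘ stMap _ _)
        (loebMeasure (ω : Germ (U : Filter I) ℕ) (η : Germ (U : Filter I) ℕ)) ∧
      Integrable (extendZero f) extendedMeasure ∧
      Integrable f lebesgueMeasure ∧
      ∫ x, (extendZero f ∘ stMap _ _) x
          ∂(loebMeasure (ω : Germ (U : Filter I) ℕ) (η : Germ (U : Filter I) ℕ))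
        = ∫ y, extendZero f y ∂extendedMeasure ∧
      ∫ y, extendZero f y ∂extendedMeasure = ∫ t, f t ∂lebesgueMeasure := by
  have hL := integrable_lebesgueMeasure hf
  obtain ⟨hE, hE'⟩ := integral_extendZero hfm hL
  obtain ⟨hS, hS'⟩ := integral_comp_of_measurePreserving (measurePreserving_stMap hη hω) hE
  exact ⟨hS, hE, hL, hS', hE'⟩

/-- The kernel `exp (-π i x t)` is the kernel `exp (-2π i x s)` at `s = t / 2`, so continuity and
integrability follow from those of a Schwartz function by dilation. -/
theorem fourierPi_eq (g : 𝓢(ℝ, ℂ)) :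
    fourierPi g = fun t => FourierTransform.fourier g (t / 2) := by
  ext t
  rw [SchwartzMap.fourier_coe, Real.fourier_real_eq_integral_exp_smul, fourierPi]
  refine integral_congr_ae (Eventually.of_forall fun x => ?_)
  simp only [smul_eq_mul]
  rw [mul_comm]
  congr 2
  push_cast
  ring

end LoebGrid

end

open LoebGrid
theorem mainTheorem2 {I : Type*} (U : Ultrafilter I) (η ω : Germ (U : Filter I) ℕ)
    (hη : ∀ n : ℕ, η ≠ (n : Germ (U : Filter I) ℕ))
    (hω : ∀ n : ℕ, (n : Germ (U : Filter I) ℕ) * η ≤ ω) :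
    @MeasurePreserving (Space ω η) EReal (loebSigma ω η) extendedSigma
      (stMap ω η) (loebMeasure ω η) extendedMeasure ∧
    ∀ g : 𝓢(ℝ, ℂ),
      (Integrable (extendZero g ∘ stMap ω η) (loebMeasure ω η) ∧
        Integrable (extendZero g) extendedMeasure ∧
        Integrable g lebesgueMeasure ∧
        ∫ x, (extendZero g ∘ stMap ω η) x ∂(loebMeasure ω η)
          = ∫ y, extendZero g y ∂extendedMeasure ∧
        ∫ y, extendZero g y ∂extendedMeasure = ∫ t, g t ∂lebesgueMeasure) ∧
      (Integrable (extendZero (fourierPi g) ∘ stMap ω η) (loebMeasure ω η) ∧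
        Integrable (extendZero (fourierPi g)) extendedMeasure ∧
        Integrable (fourierPi g) lebesgueMeasure ∧
        ∫ x, (extendZero (fourierPi g) ∘ stMap ω η) x ∂(loebMeasure ω η)
          = ∫ y, extendZero (fourierPi g) y ∂extendedMeasure ∧
        ∫ y, extendZero (fourierPi g) y ∂extendedMeasure
          = ∫ t, fourierPi g t ∂lebesgueMeasure) := by
  induction η using Germ.inductionOn with | _ η
  induction ω using Germ.inductionOn with | _ ω
  have hη' : Tendsto η U atTop := tendsto_atTop_of_ne_natCast hη
  have hω' : Tendsto (fun k => (ω k : ℝ) / (η k : ℝ)) U atTop :=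
    tendsto_atTop_of_natCast_mul_le hη' hω
  refine ⟨measurePreserving_stMap hη' hω', fun g => ⟨?_, ?_⟩⟩
  · exact integral_transfer hη' hω' g.continuous.measurable g.integrable
  · rw [fourierPi_eq]
    refine integral_transfer hη' hω' ?_ ?_
    · exact ((FourierTransform.fourier g).continuous.comp (continuous_id.div_const 2)).measurable
    · exact (FourierTransform.fourier g).integrable.comp_div two_ne_zero
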